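/- Let $m\ge 1$, let $K=\mathbb F_{2^m}$, let $k\ge 0$ be an integer with $\gcd(k,m)=1$, and let $\sigma$ be the automorphism $x\mapsto x^{2^k}$ of $K$. Let $\alpha\in K$ be such that $X^{\sigma+1}+X+\alpha$ has no root in $K$, and define $F_{\alpha,\sigma}\colon K^2\to K^2$ by \[F_{\alpha,\sigma}(x,y)=\bigl(x^{\sigma+1}+xy^{\sigma}+\alpha y^{\sigma+1},\; x^{\sigma^2+1}+\alpha x^{\sigma^2}y+(1+\alpha^{\sigma})xy^{\sigma^2}+\alpha y^{\sigma^2+1}\bigr).\] (Here $x^{\sigma}=\sigma(x)$, $x^{\sigma+1}=\sigma(x)x$, $x^{\sigma^2}=\sigma(\sigma(x))$, etc.) Call a function $G\colon K^2\to K^2$ APN if $\max_{a\neq 0,\,b}|\{x\in K^2 : G(x+a)+G(x)=b\}|=2$. Then: 1. $F_{\alpha,\sigma}$ is APN. 2. $F_{\alpha,\sigma}$ is $3$-to-$1$: $F_{\alpha,\sigma}(v)=0$ if and only if $v=0$, and every nonzero element of the image of $F_{\alpha,\sigma}$ has precisely $3$ preimages. 3. The image of $F_{\alpha,\sigma}$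 has the minimal size for an APN function: $|\mathrm{Im}(F_{\alpha,\sigma})|\le|\mathrm{Im}(G)|$ for every APN function $G\colon K^2\to K^2$. 4. $F_{\alpha,\sigma}$ has the classical (Gold-like) extended Walsh spectrum. That is, put $n=2m$, let $e\colon K^2\to\mathbb F_{2^n}$ be any additive bijection, and let $F=e\circ F_{\alpha,\sigma}\circ e^{-1}$. With $W_F(b,a)=\sum_{x\in\mathbb F_{2^n}}(-1)^{\mathrm{Tr}(bF(x)+ax)}$, where $\mathrm{Tr}$ is the trace from $\mathbb F_{2^n}$ to $\mathbb F_2$, the multiset of all $|W_F(b,a)|$ with $b\in\mathbb F_{2^n}^*$, $a\in\mathbb F_{2^n}$ consists of the values $0$, $2^{n/2}$, $2^{(n+2)/2}$, taken precisely $(2^n-1)2^{n-2}$, $(2^n-1)2^{n+1}/3$ and $(2^n-1)2^{n-2}/3$ times, respectively. -/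

import Mathlib

open Classical in
/-- Differential uniformity of `F : V → V`, where `V` is (the additive group of) a finite field of
characteristic two or a product of such: the maximum over `a ≠ 0` and `b` of the number of
solutions `x` of `F (x + a) + F x = b`. -/
noncomputable def differentialUniformity {V : Type*} [AddCommGroup V] [Fintype V]
    (F : V → V) : ℕ :=
  ((Finset.univ.erase (0 : V)) ×ˢ (Finset.univ : Finset V)).sup
    fun p => (Finset.univ.filter fun x : V => F (x + p.1) + F x = p.2).card

/-- Almost perfect nonlinear functions: differential uniformity equal to two. -/
def IsAPN {V : Type*} [AddCommGroup V] [Fintype V] (F : V → V) : Prop :=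
  differentialUniformity F = 2

/-- `F` is 3-to-1: `F x = 0` only for `x = 0`, and every nonzero element of the image has
precisely three preimages. -/
def IsThreeToOne {V : Type*} [AddCommGroup V] (F : V → V) : Prop :=
  (∀ x, F x = 0 ↔ x = 0) ∧ ∀ y ∈ Set.range F, y ≠ 0 → (F ⁻¹' {y}).ncard = 3

/-- The Walsh transform `W_F(b,a) = ∑ₓ (-1)^{Tr(b F(x) + a x)}` of a function on a finite field of
characteristic two, with `Tr` the absolute trace. -/
noncomputable def walsh {L : Type*} [Field L] [Fintype L] [Algebra (ZMod 2) L]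
    (F : L → L) (b a : L) : ℤ :=
  ∑ x : L, (-1 : ℤ) ^ (Algebra.trace (ZMod 2) L (b * F x + a * x)).val

open Classical in
/-- The extended Walsh spectrum: the multiset of all `|W_F(b,a)|` with `b ≠ 0` and `a` arbitrary. -/
noncomputable def extendedWalshSpectrum {L : Type*} [Field L] [Fintype L] [Algebra (ZMod 2) L]
    (F : L → L) : Multiset ℕ :=
  ((Finset.univ.erase (0 : L)) ×ˢ (Finset.univ : Finset L)).val.map
    fun p => (walsh F p.1 p.2).natAbs

/-- The classical (Gold-like) extended Walsh spectrum in even dimension `n ≥ 2`: the values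
`0`, `2^(n/2)`, `2^((n+2)/2)` occur precisely `(2^n-1) 2^(n-2)`, `(2^n-1) 2^(n+1) / 3` and
`(2^n-1) 2^(n-2) / 3` times, and no other value occurs. For even `n`, `3` divides `2^n - 1`. -/
noncomputable def HasClassicalWalshSpectrum {L : Type*} [Field L] [Fintype L]
    [Algebra (ZMod 2) L] (n : ℕ) (F : L → L) : Prop :=
  extendedWalshSpectrum F =
    Multiset.replicate ((2 ^ n - 1) * 2 ^ (n - 2)) 0 +
    Multiset.replicate ((2 ^ n - 1) * 2 ^ (n + 1) / 3) (2 ^ (n / 2)) +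
    Multiset.replicate ((2 ^ n - 1) * 2 ^ (n - 2) / 3) (2 ^ ((n + 2) / 2))

/-- The member of the extended family with parameters `α` and `σ`:
`(x^{σ+1} + x y^σ + α y^{σ+1},
  x^{σ²+1} + α x^{σ²} y + (1 + α^σ) x y^{σ²} + α y^{σ²+1})`. -/
def extFamily {K : Type*} [Field K] (α : K) (σ : K ≃+* K) : K × K → K × K :=
  fun p =>
    (σ p.1 * p.1 + p.1 * σ p.2 + α * (σ p.2 * p.2),
     σ (σ p.1) * p.1 + α * (σ (σ p.1) * p.2) + (1 + σ α) * (p.1 * σ (σ p.2))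
       + α * (σ (σ p.2) * p.2))

/-! ### Counting over the fibres of a 3-to-1 map. -/

section Fibers

/-! The semilinear map Φ = `twist α σ` turns the family into determinants: up to nonzero constants,
the coordinates of `extFamily α σ v` are det(Φv, v) and det(Φ²v, v) (`extFamily_eq_planeDet`). The
no-root condition says exactly that Φv and v are independent for v ≠ 0. Two nonzero vectors have the
same value if and only if a linear map commuting with Φ carries one to the other. Determinant and
trace of such a map are fixed by σ, hence lie in 𝔽₂. This leaves only 0, 1, ω, ω + 1, where ω = Φ^m
is linear and differs from 1 by a Hilbert 90 argument. The nonzero fibres are the orbits of this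
copy of 𝔽₄ˣ, so the map is 3-to-1.

The rest holds for any quadratic 3-to-1 map on a field of size 2^(2m). Each W(b,0) is ≡ 1 mod 3, and
its square is |L| times the size of a radical, so it is a power of -2. The first two moments over b
then force W(b,0) ∈ {(-2)^m, (-2)^(m+1)} for b ≠ 0 (`walsh_zero_cases`), which fixes the sizes of
all radicals and how often each occurs. This gives the Walsh spectrum, and counting the zeros of the
polar form in two ways gives APN (`eq_or_eq_of_form_eq_zero`). Minimality of the image is
Cauchy–Schwarz on fibre sizes (`IsAPN.card_sq_le`). -/

open Classical in
theorem IsThreeToOne.sum_comp {V R : Type*} [AddCommGroup V] [Fintype V] [CommRing R] {H : V → V}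
    (hH : IsThreeToOne H) (φ : V → R) :
    ∑ x, φ (H x) = φ 0 + 3 * ∑ y ∈ (Finset.univ.image H).erase 0, φ y := by
  have h0 : (0 : V) ∈ Finset.univ.image H := Finset.mem_image.2 ⟨0, Finset.mem_univ _, (hH.1 0).2 rfl⟩
  rw [Finset.sum_comp, ← Finset.add_sum_erase _ _ h0, Finset.mul_sum]
  congr 1
  · have : (Finset.univ.filter fun x => H x = 0) = {0} := by
      ext x; simp [hH.1 x]
    rw [this]; simp
  · refine Finset.sum_congr rfl fun y hy => ?_
    rw [Finset.mem_erase, Finset.mem_image] at hy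
    obtain ⟨hy0, x, -, rfl⟩ := hy
    have h3 := hH.2 _ ⟨x, rfl⟩ hy0
    rw [Set.ncard_eq_toFinset_card'] at h3
    have : (Finset.univ.filter fun x' => H x' = H x) = (H ⁻¹' {H x}).toFinset := by
      ext; simp
    rw [this, h3]; simp

open Classical in
theorem IsThreeToOne.three_mul_ncard_range {V : Type*} [AddCommGroup V] [Fintype V] {H : V → V}
    (hH : IsThreeToOne H) : 3 * (Set.range H).ncard = Fintype.card V + 2 := by
  have h := hH.sum_comp (fun _ => (1 : ℤ))
  have h0 : (0 : V) ∈ Finset.univ.image H := Finset.mem_image.2 ⟨0, Finset.mem_univ _, (hH.1 0).2 rfl⟩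
  have hr : (Set.range H).ncard = (Finset.univ.image H).card := by
    rw [← Set.ncard_coe_finset]; simp
  have := Finset.card_erase_add_one h0
  simp at h
  omega

open Classical in
theorem IsThreeToOne.card_eq_pairs {V : Type*} [AddCommGroup V] [Fintype V] {H : V → V}
    (hH : IsThreeToOne H) :
    ∑ x, ∑ y, (if H x = H y then (1 : ℤ) else 0) = 3 * Fintype.card V - 2 := by
  have h1 : ∀ x, ∑ y, (if H x = H y then (1 : ℤ) else 0) = if x = 0 then 1 else 3 := fun x => by
    have := hH.sum_comp (fun z => if H x = z then (1 : ℤ) else 0)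
    rw [this]
    simp only [Finset.sum_ite_eq, Finset.mem_erase, hH.1 x, Finset.mem_image, Finset.mem_univ,
      true_and, exists_apply_eq_apply, and_true]
    by_cases hx : x = 0
    · subst hx
      simp [(hH.1 0).2 rfl]
    · have hx' : H x ≠ 0 := fun h => hx ((hH.1 x).1 h)
      simp [hx, hx']
  simp only [h1]
  rw [← Finset.add_sum_erase _ _ (Finset.mem_univ (0 : V)),
    Finset.sum_congr rfl (g := fun _ => (3 : ℤ)) fun x hx => if_neg (Finset.ne_of_mem_erase hx)]
  rw [Finset.sum_const, Finset.card_erase_of_mem (Finset.mem_univ _), Finset.card_univ,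
    nsmul_eq_mul, Nat.cast_sub Fintype.card_pos]
  simp; ring

end Fibers

/-! ### Walsh transform of a quadratic 3-to-1 function. -/

section Walsh

variable {L : Type*} [Field L] [Fintype L] [Algebra (ZMod 2) L]

variable (L) in
/-- The additive character `x ↦ (-1)^{Tr x}`. -/
noncomputable def traceSign : AddChar L ℤ where
  toFun x := (-1) ^ (Algebra.trace (ZMod 2) L x).val
  map_zero_eq_one' := by simp
  map_add_eq_mul' x y := by
    rw [map_add]
    generalize Algebra.trace (ZMod 2) L x = a
    generalize Algebra.trace (ZMod 2) L y = b
    revert a b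
    decide

theorem walsh_eq (H : L → L) (b a : L) :
    walsh H b a = ∑ x, traceSign L (b * H x + a * x) := rfl

omit [Fintype L] in
theorem traceSign_mul_self (x : L) : traceSign L x * traceSign L x = 1 := by
  change (-1 : ℤ) ^ _ * (-1) ^ _ = 1
  rw [← pow_add, ← two_mul, pow_mul]; simp

theorem traceSign_isPrimitive : (traceSign L).IsPrimitive := by
  refine AddChar.IsPrimitive.of_ne_one (AddChar.ne_one_iff.2 ?_)
  obtain ⟨x, hx⟩ := Algebra.trace_surjective (ZMod 2) L 1
  refine ⟨x, ?_⟩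
  change (-1 : ℤ) ^ (Algebra.trace (ZMod 2) L x).val ≠ 1
  rw [hx]
  decide

open Classical in
theorem sum_traceSign_mul (c : L) :
    ∑ x : L, traceSign L (x * c) = if c = 0 then (Fintype.card L : ℤ) else 0 := by
  rw [AddChar.sum_mulShift c traceSign_isPrimitive]
  split_ifs <;> simp

/-- The radical of the bilinear form `(x, u) ↦ Tr (b B(x,u))`. -/
noncomputable def walshRadical (B : L →+ L →+ L) (b : L) : AddSubgroup L where
  carrier := {u | ∀ x, traceSign L (b * B x u) = 1}
  zero_mem' x := by simp
  add_mem' {u v} hu hv x := by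
    rw [map_add, mul_add, AddChar.map_add_eq_mul, hu, hv, one_mul]
  neg_mem' {u} hu x := by
    rw [map_neg, ← AddMonoidHom.neg_apply, ← map_neg, hu]

variable {H : L → L} {B : L →+ L →+ L}

open Classical in
theorem sum_traceSign_form (B : L →+ L →+ L) (b u : L) :
    ∑ x, traceSign L (b * B x u) =
      if u ∈ walshRadical B b then (Fintype.card L : ℤ) else 0 := by
  let ψ : AddChar L ℤ :=
    { toFun := fun x => traceSign L (b * B x u)
      map_zero_eq_one' := by simp
      map_add_eq_mul' := fun x y => by
        rw [map_add, AddMonoidHom.add_apply, mul_add, AddChar.map_add_eq_mul] }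
  have := AddChar.sum_eq_ite ψ
  have h : ψ = 0 ↔ u ∈ walshRadical B b := by
    rw [AddChar.eq_zero_iff]; rfl
  simp only [h] at this
  exact this

-- Squaring and substituting y = x + u leaves an inner sum of the character x ↦ (-1)^{Tr(b B(x,u))},
-- which vanishes unless u is in the radical.
open Classical in
theorem walsh_sq (hB : ∀ x y, H (x + y) = H x + H y + B x y) (b a : L) :
    walsh H b a ^ 2 =
      Fintype.card L * ∑ u : walshRadical B b, traceSign L (b * H u + a * u) := by
  have h1 : walsh H b a ^ 2 =
      ∑ u, traceSign L (b * H u + a * u) * ∑ x, traceSign L (b * B x u) := by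
    simp only [sq, walsh_eq, Finset.sum_mul_sum]
    simp only [Finset.mul_sum]
    conv_rhs => rw [Finset.sum_comm]
    refine Finset.sum_congr rfl fun x _ => ?_
    refine (Fintype.sum_equiv (Equiv.addLeft x) _ _ fun u => ?_).symm
    rw [Equiv.coe_addLeft, hB]
    have e : b * (H x + H u + B x u) + a * (x + u) =
        (b * H x + a * x) + ((b * H u + a * u) + b * B x u) := by ring
    rw [e, AddChar.map_add_eq_mul _ (b * H x + a * x), ← mul_assoc, traceSign_mul_self, one_mul,
      AddChar.map_add_eq_mul _ (b * H u + a * u)]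
  rw [h1, Finset.mul_sum]
  simp only [sum_traceSign_form, mul_ite, mul_zero]
  rw [← Finset.sum_filter, Finset.sum_subtype (p := fun u => u ∈ walshRadical B b) _ (by simp)]
  exact Finset.sum_congr rfl fun _ _ => mul_comm _ _

/-- On the radical the cross term b B(u,v) has trivial sign, so the summand in `walsh_sq` is a
character there: it is trivial or sums to zero. -/
theorem walsh_sq_eq_or (hB : ∀ x y, H (x + y) = H x + H y + B x y) (b a : L) :
    ((∀ u ∈ walshRadical B b, traceSign L (b * H u + a * u) = 1) ∧
      walsh H b a ^ 2 = Fintype.card L * Nat.card (walshRadical B b)) ∨ walsh H b a = 0 := by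
  classical
  have hH0 : H 0 = 0 := by simpa using hB 0 0
  let ψ : AddChar (walshRadical B b) ℤ :=
    { toFun := fun u => traceSign L (b * H u + a * u)
      map_zero_eq_one' := by simp [hH0]
      map_add_eq_mul' := fun u v => by
        rw [AddSubgroup.coe_add, hB]
        have e : b * (H u + H v + B u v) + a * (u + v : L) =
          ((b * H u + a * u) + (b * H v + a * v)) + b * B u v := by ring
        rw [e, AddChar.map_add_eq_mul, AddChar.map_add_eq_mul, v.2 u, mul_one] }
  have h1 := walsh_sq hB b a
  have h2 := AddChar.sum_eq_ite ψ
  change ∑ u : walshRadical B b, traceSign L (b * H u + a * u) = _ at h2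
  rw [h2] at h1
  split_ifs at h1 with h
  · left
    rw [AddChar.eq_zero_iff] at h
    exact ⟨fun u hu => h ⟨u, hu⟩, by rw [h1, Nat.card_eq_fintype_card]⟩
  · right
    simpa using h1

/-- The point 0 contributes 1, and all other terms come in fibres of size three. -/
theorem walsh_zero_modEq (hH : IsThreeToOne H) (b : L) :
    ∃ c : ℤ, walsh H b 0 = 1 + 3 * c := by
  classical
  have := hH.sum_comp (fun y => traceSign L (b * y))
  rw [mul_zero, AddChar.map_zero_eq_one] at this
  simp only [walsh_eq, zero_mul, add_zero]
  exact ⟨_, this⟩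

/-- The residue mod 3 determines the sign, since -2 ≡ 1. -/
theorem eq_neg_two_pow {W c : ℤ} {l : ℕ} (hW : W = 1 + 3 * c) (hl : W.natAbs = 2 ^ l) :
    W = (-2) ^ l := by
  have h3 : (-2 : ℤ) ^ l ≡ 1 [ZMOD 3] := by
    have : (-2 : ℤ) ≡ 1 [ZMOD 3] := by decide
    simpa using this.pow l
  have h4 : ((-2 : ℤ) ^ l).natAbs = 2 ^ l := by simp [Int.natAbs_pow]
  rw [← h4, Int.natAbs_eq_natAbs_iff] at hl
  rcases hl with h | h
  · exact h
  · have := h3.dvd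
    omega

theorem exists_walsh_zero_eq (hB : ∀ x y, H (x + y) = H x + H y + B x y) (hH : IsThreeToOne H)
    {m : ℕ} (hL : Fintype.card L = 2 ^ (2 * m)) (b : L) :
    ∃ i : ℕ, walsh H b 0 = (-2) ^ (m + i) ∧ Nat.card (walshRadical B b) = 4 ^ i := by
  obtain ⟨c, hc⟩ := walsh_zero_modEq hH b
  have hsq : walsh H b 0 ^ 2 = Fintype.card L * Nat.card (walshRadical B b) := by
    rcases walsh_sq_eq_or hB b 0 with h | h
    · exact h.2
    · omega
  have hdvd : Nat.card (walshRadical B b) ∣ 2 ^ (2 * m) := by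
    rw [← hL, ← Nat.card_eq_fintype_card]
    exact AddSubgroup.card_addSubgroup_dvd_card _
  obtain ⟨j, -, hj⟩ := (Nat.dvd_prime_pow Nat.prime_two).1 hdvd
  have hn : (walsh H b 0).natAbs ^ 2 = 2 ^ (2 * m + j) := by
    have := congrArg Int.natAbs hsq
    rw [Int.natAbs_pow, hL, hj] at this
    rw [this, pow_add]
    simp [Int.natAbs_mul, Int.natAbs_pow]
  obtain ⟨l, -, hl⟩ := (Nat.dvd_prime_pow Nat.prime_two).1
    ((Dvd.intro_left _ (pow_succ _ 1).symm).trans hn.dvd)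
  have hlj : l * 2 = 2 * m + j := by
    rw [hl, ← pow_mul] at hn
    exact Nat.pow_right_injective le_rfl hn
  obtain ⟨i, rfl⟩ : ∃ i, l = m + i := ⟨l - m, by omega⟩
  refine ⟨i, eq_neg_two_pow hc hl, ?_⟩
  rw [hj, show j = 2 * i by omega, pow_mul]
  norm_num

theorem sum_walsh_zero (hH : IsThreeToOne H) : ∑ b, walsh H b 0 = Fintype.card L := by
  classical
  simp only [walsh_eq, zero_mul, add_zero]
  rw [Finset.sum_comm]
  simp [sum_traceSign_mul, hH.1]

theorem sum_walsh_zero_sq (hH : IsThreeToOne H) :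
    ∑ b, walsh H b 0 ^ 2 = Fintype.card L * (3 * Fintype.card L - 2) := by
  classical
  have : CharP L 2 := charP_of_injective_algebraMap (algebraMap (ZMod 2) L).injective 2
  rw [← hH.card_eq_pairs]
  simp only [sq, walsh_eq, zero_mul, add_zero, Finset.sum_mul_sum, ← AddChar.map_add_eq_mul,
    ← mul_add]
  rw [Finset.sum_comm, Finset.mul_sum]
  refine Finset.sum_congr rfl fun x _ => ?_
  rw [Finset.sum_comm, Finset.mul_sum]
  refine Finset.sum_congr rfl fun y _ => ?_
  rw [sum_traceSign_mul, CharTwo.add_eq_zero]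
  simp

theorem walsh_zero_zero (H : L → L) : walsh H 0 0 = Fintype.card L := by
  simp [walsh_eq]

/-- The quadratic (W - A)(W + 2A) with A = (-2)^m is nonnegative at every A(-2)^i, while the first
two moments make its sum over b ≠ 0 vanish. Every term is therefore zero. -/
theorem walsh_zero_cases (hB : ∀ x y, H (x + y) = H x + H y + B x y) (hH : IsThreeToOne H)
    {m : ℕ} (hL : Fintype.card L = 2 ^ (2 * m)) {b : L} (hb : b ≠ 0) :
    (walsh H b 0 = (-2) ^ m ∧ Nat.card (walshRadical B b) = 1) ∨
      (walsh H b 0 = (-2) ^ m * (-2) ∧ Nat.card (walshRadical B b) = 4) := by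
  classical
  set A : ℤ := (-2) ^ m with hA
  have hA0 : A ≠ 0 := by positivity
  have hA2 : A ^ 2 = Fintype.card L := by
    rw [hL, hA, ← pow_mul, mul_comm m 2, pow_mul]; push_cast; rw [pow_mul]; norm_num
  let g : L → ℤ := fun b => (walsh H b 0 - A) * (walsh H b 0 + 2 * A)
  have hfac : ∀ b, ∃ i : ℕ, walsh H b 0 = A * (-2) ^ i ∧
      Nat.card (walshRadical B b) = 4 ^ i := fun b => by
    obtain ⟨i, hi, hr⟩ := exists_walsh_zero_eq hB hH hL b
    exact ⟨i, by rw [hi, pow_add], hr⟩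
  -- A power of -2 is never strictly between -2 and 1.
  have hint : ∀ i : ℕ, 0 ≤ ((-2 : ℤ) ^ i - 1) * ((-2) ^ i + 2) := fun i => by
    rcases i with - | i
    · simp
    · have h0 : (-2 : ℤ) ^ i ≠ 0 := by positivity
      rw [pow_succ]
      generalize (-2 : ℤ) ^ i = t at h0
      rcases lt_or_gt_of_ne h0 with h | h <;> nlinarith
  have hg : ∀ b ∈ Finset.univ.erase (0 : L), 0 ≤ g b := fun b _ => by
    obtain ⟨i, hi, -⟩ := hfac b
    have : g b = A ^ 2 * (((-2 : ℤ) ^ i - 1) * ((-2) ^ i + 2)) := by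
      simp only [g, hi]; ring
    rw [this]
    exact mul_nonneg (sq_nonneg _) (hint i)
  have hsum : ∑ b ∈ Finset.univ.erase (0 : L), g b = 0 := by
    have h1 := sum_walsh_zero hH
    have h2 := sum_walsh_zero_sq hH
    rw [← Finset.add_sum_erase _ _ (Finset.mem_univ (0 : L)), walsh_zero_zero] at h1 h2
    have h3 : ∀ b, g b = walsh H b 0 ^ 2 + A * walsh H b 0 - 2 * A ^ 2 := fun b => by
      simp only [g]; ring
    simp only [h3, Finset.sum_sub_distrib, Finset.sum_add_distrib, ← Finset.mul_sum]
    rw [Finset.sum_const, Finset.card_erase_of_mem (Finset.mem_univ _), Finset.card_univ,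
      nsmul_eq_mul, Nat.cast_sub Fintype.card_pos, hA2]
    push_cast
    linear_combination h2 + A * h1
  have hgb := (Finset.sum_eq_zero_iff_of_nonneg hg).1 hsum b (by simpa using hb)
  obtain ⟨i, hi, hr⟩ := hfac b
  have habs : ((-2 : ℤ) ^ i).natAbs = 2 ^ i := by simp [Int.natAbs_pow]
  rcases mul_eq_zero.1 hgb with h | h
  · left
    have h' : walsh H b 0 = A := by linear_combination h
    refine ⟨h', ?_⟩
    have : (-2 : ℤ) ^ i = 1 := mul_left_cancel₀ hA0 (by rw [← hi, h', mul_one])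
    rw [this] at habs
    have : i = 0 := by
      by_contra h0
      have := Nat.one_lt_two_pow h0
      simp at habs; omega
    rw [hr, this, pow_zero]
  · right
    have h' : walsh H b 0 = A * (-2) := by linear_combination h
    refine ⟨h', ?_⟩
    have : (-2 : ℤ) ^ i = -2 := mul_left_cancel₀ hA0 (by rw [← hi, h'])
    rw [this] at habs
    have : 1 = i := Nat.pow_right_injective (le_refl 2) (by simpa using habs)
    rw [hr, ← this, pow_one]

theorem sum_walsh_sq (hB : ∀ x y, H (x + y) = H x + H y + B x y) (b : L) :
    ∑ a, walsh H b a ^ 2 = (Fintype.card L : ℤ) ^ 2 := by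
  classical
  simp only [walsh_sq hB, ← Finset.mul_sum, AddChar.map_add_eq_mul]
  rw [Finset.sum_comm]
  simp only [← Finset.mul_sum, sum_traceSign_mul]
  have hH0 : H 0 = 0 := by simpa using hB 0 0
  rw [Finset.sum_eq_single (0 : walshRadical B b)]
  · simp [hH0, sq]
  · intro u _ hu
    rw [if_neg (by simpa using hu), mul_zero]
  · simp

open Classical in
-- Parseval: all nonzero squares W(b,a)² have the same value |L|·|radical|, and they sum to |L|².
theorem card_walsh_ne_zero (hB : ∀ x y, H (x + y) = H x + H y + B x y) (b : L) :
    (Finset.univ.filter fun a => walsh H b a ≠ 0).card * Nat.card (walshRadical B b) =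
      Fintype.card L := by
  have h := sum_walsh_sq hB b
  have h1 : ∀ a, walsh H b a ^ 2 = if walsh H b a ≠ 0 then
      (Fintype.card L * Nat.card (walshRadical B b) : ℤ) else 0 := fun a => by
    split_ifs with h0
    · exact ((walsh_sq_eq_or hB b a).resolve_right h0).2
    · rw [not_not] at h0
      simp [h0]
  rw [Finset.sum_congr rfl fun a _ => h1 a, ← Finset.sum_filter, Finset.sum_const,
    nsmul_eq_mul, sq] at h
  have hc : (Fintype.card L : ℤ) ≠ 0 := by simp
  have := mul_left_cancel₀ hc (show (Fintype.card L : ℤ) *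
    ((Finset.univ.filter fun a => walsh H b a ≠ 0).card * Nat.card (walshRadical B b)) = _ by
      rw [← h]; ring)
  exact_mod_cast this

open Classical in
theorem card_natAbs_walsh (hB : ∀ x y, H (x + y) = H x + H y + B x y) (b : L) {s : ℕ} (hs : s ≠ 0)
    (hr : Fintype.card L * Nat.card (walshRadical B b) = s ^ 2) (c : ℕ) :
    (Finset.univ.filter fun a => c = (walsh H b a).natAbs).card =
      (if c = s then Fintype.card L / Nat.card (walshRadical B b) else 0) +
      (if c = 0 then Fintype.card L - Fintype.card L / Nat.card (walshRadical B b) else 0) := by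
  have hN := card_walsh_ne_zero hB b
  have hrpos : 0 < Nat.card (walshRadical B b) := Nat.card_pos
  rw [← Nat.eq_div_of_mul_eq_left hrpos.ne' hN]
  have habs : ∀ a, walsh H b a ≠ 0 → (walsh H b a).natAbs = s := fun a ha => by
    have := ((walsh_sq_eq_or hB b a).resolve_right ha).2
    have h2 : (walsh H b a).natAbs ^ 2 = s ^ 2 := by
      rw [← hr, ← Int.natAbs_pow, this]
      simp [Int.natAbs_mul]
    exact Nat.pow_left_injective two_ne_zero h2
  by_cases hc0 : c = 0
  · subst hc0
    rw [if_neg (Ne.symm hs), if_pos rfl, zero_add, ← Finset.card_compl]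
    congr 1
    ext a
    simp [eq_comm]
  · rw [if_neg hc0, add_zero]
    split_ifs with hcs
    · congr 1
      ext a
      simp only [Finset.mem_filter, Finset.mem_univ, true_and]
      constructor
      · intro h h0
        exact hc0 (by rw [h, h0]; rfl)
      · intro h
        rw [habs a h, hcs]
    · rw [Finset.card_eq_zero, Finset.filter_eq_empty_iff]
      intro a _ h
      by_cases h0 : walsh H b a = 0
      · exact hc0 (by rw [h, h0]; rfl)
      · exact hcs (h.trans (habs a h0))

open Classical in
/-- Distribution of the nontrivial component functions of a quadratic 3-to-1 function. -/
theorem card_walshRadical_distribution (hB : ∀ x y, H (x + y) = H x + H y + B x y)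
    (hH : IsThreeToOne H) {m : ℕ} (hL : Fintype.card L = 2 ^ (2 * m)) :
    ∃ N : ℕ, Fintype.card L = 3 * N + 1 ∧
      ((Finset.univ.erase (0 : L)).filter fun b => Nat.card (walshRadical B b) = 1).card = 2 * N ∧
      ((Finset.univ.erase (0 : L)).filter fun b => ¬ Nat.card (walshRadical B b) = 1).card = N := by
  set S := Finset.univ.erase (0 : L)
  refine ⟨_, ?_, ?_, rfl⟩
  all_goals
    -- Since W(0,0) = |L| is already the full first moment, the values with b ≠ 0 sum to zero. So
    -- trivial radicals are twice as frequent as nontrivial ones.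
    have h1 := sum_walsh_zero hH
    rw [← Finset.add_sum_erase _ _ (Finset.mem_univ (0 : L)), walsh_zero_zero] at h1
    have h2 : ∀ b ∈ S, walsh H b 0 =
        (-2) ^ m * if Nat.card (walshRadical B b) = 1 then 1 else -2 := fun b hb => by
      rcases walsh_zero_cases hB hH hL (Finset.ne_of_mem_erase hb) with h | h
      · rw [h.1, if_pos h.2, mul_one]
      · rw [h.1, if_neg (by rw [h.2]; norm_num)]
    rw [Finset.sum_congr rfl h2, ← Finset.mul_sum, Finset.sum_ite, add_eq_left] at h1
    have h3 := (mul_eq_zero.1 h1).resolve_left (by positivity)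
    simp only [Finset.sum_const, nsmul_eq_mul] at h3
    have h4 := Finset.card_filter_add_card_filter_not (s := S)
      (fun b => Nat.card (walshRadical B b) = 1)
    have h5 : S.card + 1 = Fintype.card L := Finset.card_erase_add_one (Finset.mem_univ _)
    omega

theorem hasClassicalWalshSpectrum_of_quadratic (hB : ∀ x y, H (x + y) = H x + H y + B x y)
    (hH : IsThreeToOne H) {m : ℕ} (hm : 0 < m) (hL : Fintype.card L = 2 ^ (2 * m)) :
    HasClassicalWalshSpectrum (2 * m) H := by
  classical
  obtain ⟨N, hN, hN1, hN2⟩ := card_walshRadical_distribution hB hH hL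
  obtain ⟨q, hq⟩ : ∃ q, q = 2 ^ (2 * m - 2) := ⟨_, rfl⟩
  have hq4 : 2 ^ (2 * m) = 4 * q := by
    rw [hq, show 2 * m = 2 * m - 2 + 2 by omega, pow_add]; simp [mul_comm]
  have hcount : ∀ c : ℕ, ∀ b ∈ Finset.univ.erase (0 : L),
      (Finset.univ.filter fun a => c = (walsh H b a).natAbs).card =
        if Nat.card (walshRadical B b) = 1 then (if c = 2 ^ m then 4 * q else 0)
        else (if c = 2 ^ (m + 1) then q else 0) + (if c = 0 then 3 * q else 0) := by
    intro c b hb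
    rcases walsh_zero_cases hB hH hL (Finset.ne_of_mem_erase hb) with ⟨-, h⟩ | ⟨-, h⟩
    · rw [card_natAbs_walsh hB b (s := 2 ^ m) (by positivity) (by rw [h, hL]; ring), h, if_pos rfl,
        Nat.div_one, hL, hq4]
      simp
    · rw [card_natAbs_walsh hB b (s := 2 ^ (m + 1)) (by positivity) (by rw [h, hL]; ring), h,
        if_neg (show ¬ (4 = 1) by norm_num), hL, hq4, Nat.mul_div_cancel_left _ (by norm_num),
        show 4 * q - q = 3 * q by omega]
  unfold HasClassicalWalshSpectrum extendedWalshSpectrum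
  ext c
  rw [Multiset.count_map, ← Finset.filter_val, Finset.card_val, Finset.card_filter,
    Finset.sum_product]
  simp only [← Finset.card_filter]
  rw [Finset.sum_congr rfl (hcount c), Finset.sum_ite, Finset.sum_const, Finset.sum_const, hN1,
    hN2, Multiset.count_add, Multiset.count_add, Multiset.count_replicate,
    Multiset.count_replicate, Multiset.count_replicate, ← hq, pow_succ 2 (2 * m), hq4, show 4 * q - 1 = 3 * N by omega,
    mul_assoc 3, mul_assoc 3,
    Nat.mul_div_cancel_left _ (by norm_num), Nat.mul_div_cancel_left _ (by norm_num),
    Nat.mul_div_cancel_left _ (by norm_num), show (2 * m + 2) / 2 = m + 1 by omega]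
  simp only [smul_eq_mul, mul_add, mul_ite, mul_zero, eq_comm (b := c)]
  have e1 : 2 * N * (4 * q) = N * (4 * q * 2) := by ring
  have e2 : N * (3 * q) = 3 * (N * q) := by ring
  rw [e1, e2]
  ring

/-- The pairs with B(x,y) = 0 are counted by x and by summing the radical sizes over b. The known
distribution of radicals makes the average kernel size over x ≠ 0 equal to 2, while each such kernel
contains 0 and x. -/
theorem eq_or_eq_of_form_eq_zero (hB : ∀ x y, H (x + y) = H x + H y + B x y)
    (hH : IsThreeToOne H) {m : ℕ} (hL : Fintype.card L = 2 ^ (2 * m)) {x y : L} (hx : x ≠ 0)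
    (hxy : B x y = 0) : y = 0 ∨ y = x := by
  classical
  have : CharP L 2 := charP_of_injective_algebraMap (algebraMap (ZMod 2) L).injective 2
  obtain ⟨N, hN, hN1, hN2⟩ := card_walshRadical_distribution hB hH hL
  let k : L → ℕ := fun x => (Finset.univ.filter fun y => B x y = 0).card
  have hc : (Fintype.card L : ℤ) ≠ 0 := by simp
  have hself : ∀ x, B x x = 0 := fun x => by
    have := hB x x
    rw [CharTwo.add_self_eq_zero, CharTwo.add_self_eq_zero, (hH.1 0).2 rfl, zero_add] at this
    exact this.symm
  have hle : ∀ x ∈ Finset.univ.erase (0 : L), 2 ≤ k x := fun x hx => by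
    rw [← Finset.card_pair (Finset.ne_of_mem_erase hx).symm]
    refine Finset.card_le_card fun y hy => ?_
    rw [Finset.mem_insert, Finset.mem_singleton] at hy
    rcases hy with rfl | rfl <;> simp [hself]
  -- Both sides times |L| are the sum of (-1)^{Tr(b B(x,y))} over all triples (b, x, y).
  have hdouble : ∑ x, (k x : ℤ) = ∑ b, (Nat.card (walshRadical B b) : ℤ) := by
    refine mul_left_cancel₀ hc ?_
    have h1 : ∀ x, (Fintype.card L : ℤ) * k x = ∑ y, ∑ b, traceSign L (b * B x y) := fun x => by
      simp only [sum_traceSign_mul, k, Finset.card_filter]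
      push_cast
      rw [Finset.mul_sum]
      simp
    have h2 : ∀ b, (Fintype.card L : ℤ) * Nat.card (walshRadical B b) =
        ∑ y, ∑ x, traceSign L (b * B x y) := fun b => by
      simp only [sum_traceSign_form]
      rw [← Finset.sum_filter, Finset.sum_const, nsmul_eq_mul, mul_comm,
        Nat.card_eq_fintype_card, Fintype.card_subtype]
    rw [Finset.mul_sum, Finset.mul_sum, Finset.sum_congr rfl fun x _ => h1 x,
      Finset.sum_congr rfl fun b _ => h2 b, Finset.sum_comm]
    conv_rhs => rw [Finset.sum_comm]
    refine Finset.sum_congr rfl fun y _ => ?_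
    rw [Finset.sum_comm]
  have hr : ∑ b, Nat.card (walshRadical B b) = Fintype.card L + 6 * N := by
    rw [← Finset.add_sum_erase _ _ (Finset.mem_univ (0 : L))]
    have h0 : Nat.card (walshRadical B 0) = Fintype.card L := by
      have : walshRadical B 0 = ⊤ := by
        rw [eq_top_iff]
        intro u _ x
        simp
      rw [this, AddSubgroup.card_top, Nat.card_eq_fintype_card]
    have h1 : ∀ b ∈ Finset.univ.erase (0 : L), Nat.card (walshRadical B b) =
        if Nat.card (walshRadical B b) = 1 then 1 else 4 := fun b hb => by
      rcases walsh_zero_cases hB hH hL (Finset.ne_of_mem_erase hb) with ⟨-, h⟩ | ⟨-, h⟩ <;>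
        rw [h] <;> norm_num
    rw [h0, Finset.sum_congr rfl h1, Finset.sum_ite, Finset.sum_const, Finset.sum_const, hN1, hN2]
    simp; ring
  have hk0 : k 0 = Fintype.card L := by simp [k]
  have hS : ∑ x ∈ Finset.univ.erase (0 : L), 2 = ∑ x ∈ Finset.univ.erase (0 : L), k x := by
    have h1 : ∑ x, k x = Fintype.card L + 6 * N := by rw [← hr]; exact_mod_cast hdouble
    rw [← Finset.add_sum_erase _ _ (Finset.mem_univ (0 : L)), hk0] at h1
    have h5 : (Finset.univ.erase (0 : L)).card + 1 = Fintype.card L :=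
      Finset.card_erase_add_one (Finset.mem_univ _)
    rw [Finset.sum_const, smul_eq_mul]
    omega
  have hk := (Finset.sum_eq_sum_iff_of_le hle).1 hS x (by simpa using hx)
  have hsub : ({0, x} : Finset L) ⊆ Finset.univ.filter fun y => B x y = 0 := fun y hy => by
    rw [Finset.mem_insert, Finset.mem_singleton] at hy
    rcases hy with rfl | rfl <;> simp [hself]
  have heq := Finset.eq_of_subset_of_card_le hsub (by rw [Finset.card_pair hx.symm]; exact hk.ge)
  have : y ∈ ({0, x} : Finset L) := by rw [heq]; simpa using hxy
  simpa using this

end Walsh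

/-! ### The semilinear twist, its centralizer, and the fibres of the family. -/

section SemilinearTwist

variable {K : Type*} [Field K]

/-- The determinant of two vectors of the plane. -/
def planeDet (v w : K × K) : K := v.1 * w.2 - v.2 * w.1

/-- The `σ`-semilinear map `(x, y) ↦ (y^σ, α⁻¹ (x^σ + y^σ))` of the plane. -/
def twist (α : K) (σ : K ≃+* K) (v : K × K) : K × K := (σ v.2, α⁻¹ * (σ v.1 + σ v.2))

theorem twist_add (α : K) (σ : K ≃+* K) (v w : K × K) :
    twist α σ (v + w) = twist α σ v + twist α σ w := by
  ext <;> simp [twist]; ring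

theorem twist_smul (α : K) (σ : K ≃+* K) (c : K) (v : K × K) :
    twist α σ (c • v) = σ c • twist α σ v := by
  ext <;> simp [twist]; ring

theorem extFamily_eq_planeDet [CharP K 2] {α : K} (hα0 : α ≠ 0) (σ : K ≃+* K) (v : K × K) :
    extFamily α σ v = (α * planeDet (twist α σ v) v,
      α * σ α * planeDet (twist α σ (twist α σ v)) v) := by
  have h0 : σ α ≠ 0 := by simpa using hα0
  have h2 : (2 : K) = 0 := CharTwo.two_eq_zero
  ext
  · simp only [extFamily, planeDet, twist]
    field_simp
    linear_combination (σ v.1 * v.1 + v.1 * σ v.2) * h2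
  · simp only [extFamily, planeDet, twist, map_mul, map_add, map_inv₀]
    field_simp
    linear_combination (σ (σ v.1) * v.1 + v.1 * σ (σ v.2) + σ α * v.1 * σ (σ v.2)) * h2

/-- For y ≠ 0, a vanishing determinant divided by σ(y)y says that x/y is a root of X^{σ+1} + X + α.
-/
theorem planeDet_twist_ne_zero [CharP K 2] {α : K} (σ : K ≃+* K)
    (hα : ∀ x : K, σ x * x + x + α ≠ 0) {v : K × K} (hv : v ≠ 0) :
    planeDet (twist α σ v) v ≠ 0 := by
  have hα0 : α ≠ 0 := by simpa using hα 0
  have h2 : (2 : K) = 0 := CharTwo.two_eq_zero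
  obtain ⟨x, y⟩ := v
  intro h
  have h' : σ x * x + x * σ y + α * (σ y * y) = 0 := by
    simp only [planeDet, twist] at h
    field_simp at h
    linear_combination -h + (α * σ y * y) * h2
  by_cases hy : y = 0
  · subst hy
    have : x = 0 := by simpa using h'
    exact hv (by simp [this])
  · have hy' : σ y ≠ 0 := by simpa using hy
    refine hα (x / y) ?_
    rw [map_div₀]
    field_simp
    linear_combination h'

/-- Cramer's rule: if v and w are independent, this expands u in terms of them. -/
theorem planeDet_smul_eq (v w u : K × K) :
    planeDet w v • u = planeDet u v • w + planeDet w u • v := by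
  ext <;> simp [planeDet] <;> ring

theorem linearMap_plane_apply (θ : K × K →ₗ[K] K × K) (v : K × K) :
    θ v = v.1 • θ (1, 0) + v.2 • θ (0, 1) := by
  rw [← map_smul, ← map_smul, ← map_add]
  congr 1
  ext <;> simp

/-- Determinant of an endomorphism of the plane. -/
def endDet (θ : K × K →ₗ[K] K × K) : K :=
  (θ (1, 0)).1 * (θ (0, 1)).2 - (θ (0, 1)).1 * (θ (1, 0)).2

/-- Trace of an endomorphism of the plane. -/
def endTrace (θ : K × K →ₗ[K] K × K) : K := (θ (1, 0)).1 + (θ (0, 1)).2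

theorem planeDet_map (θ : K × K →ₗ[K] K × K) (v w : K × K) :
    planeDet (θ v) (θ w) = endDet θ * planeDet v w := by
  rw [linearMap_plane_apply θ v, linearMap_plane_apply θ w]
  simp [planeDet, endDet]
  ring

theorem planeDet_map_trace (θ : K × K →ₗ[K] K × K) (v w : K × K) :
    planeDet (θ v) w + planeDet v (θ w) = endTrace θ * planeDet v w := by
  rw [linearMap_plane_apply θ v, linearMap_plane_apply θ w]
  simp [planeDet, endTrace]
  ring

theorem planeDet_twist_twist (α : K) (σ : K ≃+* K) (v w : K × K) :
    planeDet (twist α σ v) (twist α σ w) = -(α⁻¹ * σ (planeDet v w)) := by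
  simp [planeDet, twist]
  ring

/-- The linear endomorphisms that commute with the twist. -/
def twistCentralizer (α : K) (σ : K ≃+* K) : AddSubgroup (K × K →ₗ[K] K × K) where
  carrier := {θ | ∀ v, θ (twist α σ v) = twist α σ (θ v)}
  zero_mem' v := by ext <;> simp [twist]
  add_mem' {θ η} hθ hη v := by
    simp only [Set.mem_ofPred_eq] at hθ hη
    simp [hθ, hη, twist_add]
  neg_mem' {θ} hθ v := by
    simp only [Set.mem_ofPred_eq] at hθ
    have := twist_smul α σ (-1) (θ v)
    simp only [neg_smul, one_smul, map_neg, map_one] at this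
    simp [hθ, this]

variable {α : K} {σ : K ≃+* K}

theorem one_mem_twistCentralizer : (1 : K × K →ₗ[K] K × K) ∈ twistCentralizer α σ := fun _ => rfl

/-- Taking determinants in θΦ = Φθ, where Φ multiplies determinants by -α⁻¹ after applying σ. -/
theorem map_endDet (hα0 : α ≠ 0) {θ : K × K →ₗ[K] K × K} (hθ : θ ∈ twistCentralizer α σ) :
    σ (endDet θ) = endDet θ := by
  have h1 := planeDet_twist_twist α σ (θ (1, 0)) (θ (0, 1))
  rw [← hθ, ← hθ, planeDet_map, planeDet_map, planeDet_twist_twist] at h1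
  have : planeDet ((1, 0) : K × K) (0, 1) = 1 := by simp [planeDet]
  rw [this] at h1
  simp only [map_one, mul_one] at h1
  field_simp at h1
  exact (neg_injective h1).symm

theorem map_endTrace (hα0 : α ≠ 0) {θ : K × K →ₗ[K] K × K} (hθ : θ ∈ twistCentralizer α σ) :
    σ (endTrace θ) = endTrace θ := by
  have h1 := planeDet_map_trace θ (twist α σ (1, 0)) (twist α σ (0, 1))
  rw [hθ, hθ, planeDet_twist_twist, planeDet_twist_twist, planeDet_twist_twist] at h1
  have h2 := congrArg σ (planeDet_map_trace θ (1, 0) (0, 1))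
  have : planeDet ((1, 0) : K × K) (0, 1) = 1 := by simp [planeDet]
  rw [this] at h1 h2
  simp only [map_one, mul_one, map_add] at h1 h2
  rw [← h2]
  field_simp at h1
  linear_combination -h1

theorem ext_of_planeDet_ne_zero {θ η : K × K →ₗ[K] K × K} {v w : K × K}
    (h : planeDet w v ≠ 0) (hv : θ v = η v) (hw : θ w = η w) : θ = η := by
  refine LinearMap.ext fun u => smul_right_injective _ h ?_
  dsimp only
  rw [← map_smul, ← map_smul, planeDet_smul_eq v w, map_add, map_add, map_smul, map_smul,
    map_smul, map_smul, hv, hw]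

theorem eq_of_apply_eq (hns : ∀ v : K × K, v ≠ 0 → planeDet (twist α σ v) v ≠ 0)
    {θ η : K × K →ₗ[K] K × K} (hθ : θ ∈ twistCentralizer α σ) (hη : η ∈ twistCentralizer α σ)
    {v : K × K} (hv : v ≠ 0) (h : θ v = η v) : θ = η :=
  ext_of_planeDet_ne_zero (hns v hv) h (by rw [hθ, hη, h])

theorem eq_zero_of_endDet_eq_zero
    (hns : ∀ v : K × K, v ≠ 0 → planeDet (twist α σ v) v ≠ 0)
    {θ : K × K →ₗ[K] K × K} (hθ : θ ∈ twistCentralizer α σ) (h : endDet θ = 0) : θ = 0 := by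
  unfold endDet at h
  -- For a singular matrix, each row (a, b) gives a kernel vector (-b, a). If both of these vanish,
  -- θ is zero.
  have key : ∃ v : K × K, v ≠ 0 ∧ θ v = 0 := by
    by_cases h1 : ((-(θ (0, 1)).1, (θ (1, 0)).1) : K × K) = 0
    · simp only [Prod.mk_eq_zero, neg_eq_zero] at h1
      by_cases h2 : ((-(θ (0, 1)).2, (θ (1, 0)).2) : K × K) = 0
      · simp only [Prod.mk_eq_zero, neg_eq_zero] at h2
        exact ⟨(1, 0), by simp, Prod.ext h1.2 h2.2⟩
      · refine ⟨_, h2, ?_⟩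
        rw [linearMap_plane_apply]
        ext
        · simp [h1]
        · simp; ring
    · refine ⟨_, h1, ?_⟩
      rw [linearMap_plane_apply]
      ext
      · simp; ring
      · simp; linear_combination h
  obtain ⟨v, hv, hv0⟩ := key
  exact eq_of_apply_eq hns hθ (zero_mem _) hv (by simpa using hv0)

theorem endDet_eq_one (hα0 : α ≠ 0) (hfix : ∀ x : K, σ x = x → x = 0 ∨ x = 1)
    (hns : ∀ v : K × K, v ≠ 0 → planeDet (twist α σ v) v ≠ 0)
    {θ : K × K →ₗ[K] K × K} (hθ : θ ∈ twistCentralizer α σ) (h : θ ≠ 0) : endDet θ = 1 :=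
  (hfix _ (map_endDet hα0 hθ)).resolve_left fun h0 => h (eq_zero_of_endDet_eq_zero hns hθ h0)

/-- With det θ = 1 in characteristic 2, det(θ - 1) equals the trace, so trace 0 would force θ = 1.
-/
theorem endTrace_eq_one [CharP K 2] (hα0 : α ≠ 0) (hfix : ∀ x : K, σ x = x → x = 0 ∨ x = 1)
    (hns : ∀ v : K × K, v ≠ 0 → planeDet (twist α σ v) v ≠ 0)
    {θ : K × K →ₗ[K] K × K} (hθ : θ ∈ twistCentralizer α σ) (h0 : θ ≠ 0) (h1 : θ ≠ 1) :
    endTrace θ = 1 := by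
  refine (hfix _ (map_endTrace hα0 hθ)).resolve_left fun ht => h1 ?_
  have hd := endDet_eq_one hα0 hfix hns hθ h0
  have h2 : (2 : K) = 0 := CharTwo.two_eq_zero
  refine sub_eq_zero.1 (eq_zero_of_endDet_eq_zero hns (sub_mem hθ one_mem_twistCentralizer) ?_)
  unfold endDet at hd ⊢
  unfold endTrace at ht
  simp
  linear_combination hd - ht + h2

/-- Any further element θ would make θ, ω and θ - ω all have trace 1, contradicting additivity of
the trace. -/
theorem mem_twistCentralizer_cases [CharP K 2] (hα0 : α ≠ 0)
    (hfix : ∀ x : K, σ x = x → x = 0 ∨ x = 1)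
    (hns : ∀ v : K × K, v ≠ 0 → planeDet (twist α σ v) v ≠ 0)
    {ω θ : K × K →ₗ[K] K × K} (hω : ω ∈ twistCentralizer α σ) (hω0 : ω ≠ 0) (hω1 : ω ≠ 1)
    (hθ : θ ∈ twistCentralizer α σ) (hθ0 : θ ≠ 0) : θ = 1 ∨ θ = ω ∨ θ = ω + 1 := by
  by_cases hθ1 : θ = 1
  · exact Or.inl hθ1
  right
  by_cases h : θ - ω = 0
  · exact Or.inl (sub_eq_zero.1 h)
  by_cases h' : θ - ω = 1
  · exact Or.inr (by rw [← h']; abel)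
  have t := endTrace_eq_one hα0 hfix hns (sub_mem hθ hω) h h'
  have t1 := endTrace_eq_one hα0 hfix hns hθ hθ0 hθ1
  have t2 := endTrace_eq_one hα0 hfix hns hω hω0 hω1
  unfold endTrace at t t1 t2
  simp at t
  exact absurd (show (1 : K) = 0 by linear_combination -t + t1 - t2) one_ne_zero

theorem iterate_twist_add (α : K) (σ : K ≃+* K) (i : ℕ) (v w : K × K) :
    (twist α σ)^[i] (v + w) = (twist α σ)^[i] v + (twist α σ)^[i] w := by
  induction i with
  | zero => rfl
  | succ i ih => simp only [Function.iterate_succ_apply', ih, twist_add]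

theorem iterate_twist_smul (α : K) (σ : K ≃+* K) (i : ℕ) (c : K) (v : K × K) :
    (twist α σ)^[i] (c • v) = σ^[i] c • (twist α σ)^[i] v := by
  induction i with
  | zero => rfl
  | succ i ih => simp only [Function.iterate_succ_apply', ih, twist_smul]

/-- The `m`-th power of the twist, which is linear if `σ` has order dividing `m`. -/
def iterateTwist (α : K) (σ : K ≃+* K) (m : ℕ) (hm : ∀ x, σ^[m] x = x) : K × K →ₗ[K] K × K where
  toFun := (twist α σ)^[m]
  map_add' := iterate_twist_add α σ m
  map_smul' c v := by rw [iterate_twist_smul, hm, RingHom.id_apply]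

theorem twist_sum {ι : Type*} (s : Finset ι) (f : ι → K × K) :
    twist α σ (∑ i ∈ s, f i) = ∑ i ∈ s, twist α σ (f i) :=
  map_sum (AddMonoidHom.mk' (twist α σ) (twist_add α σ)) f s

/-- Dedekind's independence of the distinct characters σ^i, i < m. -/
theorem exists_sum_iterate_ne_zero {m : ℕ} (hm : 0 < m)
    (hinj : ∀ i < m, ∀ j < m, (∀ x, σ^[i] x = σ^[j] x) → i = j) (a : ℕ → K) (ha : a 0 ≠ 0) :
    ∃ c : K, ∑ i ∈ Finset.range m, σ^[i] c * a i ≠ 0 := by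
  by_contra! hall
  have hli := linearIndependent_monoidHom K K
  let f : Fin m → (K →* K) := fun i => ((σ ^ (i : ℕ) : K ≃+* K) : K →* K)
  have hf : ∀ i x, f i x = σ^[i] x := fun i x => by
    simp [f, RingAut.coe_pow]
  have hfi : Function.Injective f := fun i j hij =>
    Fin.ext (hinj i i.2 j j.2 fun x => by rw [← hf, ← hf, hij])
  have hli' := hli.comp f hfi
  rw [Fintype.linearIndependent_iff] at hli'
  refine ha (hli' (fun i => a i) ?_ ⟨0, hm⟩)
  ext c
  have := hall c
  rw [Finset.sum_range] at this
  simp only [Finset.sum_apply, Pi.smul_apply, Function.comp_apply, hf, smul_eq_mul]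
  simpa [mul_comm, hf] using this

/-- Hilbert 90: if Φ^m = 1, summing the Φ-orbit of c·(1,0) for a suitable c gives a nonzero vector
fixed by Φ, but Φw and w must be independent. -/
theorem iterateTwist_ne_one {m : ℕ} (hm : 0 < m) (hσm : ∀ x, σ^[m] x = x)
    (hinj : ∀ i < m, ∀ j < m, (∀ x, σ^[i] x = σ^[j] x) → i = j)
    (hns : ∀ v : K × K, v ≠ 0 → planeDet (twist α σ v) v ≠ 0) :
    iterateTwist α σ m hσm ≠ 1 := by
  intro h1
  obtain ⟨c, hc⟩ := exists_sum_iterate_ne_zero hm hinj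
    (fun i => ((twist α σ)^[i] (1, 0)).1) (by simp)
  set w : K × K := ∑ i ∈ Finset.range m, (twist α σ)^[i] (c • (1, 0)) with hw
  have hw0 : w ≠ 0 := by
    intro h0
    apply hc
    have := congrArg Prod.fst h0
    rw [hw, Prod.fst_sum] at this
    simpa [iterate_twist_smul, -Prod.smul_mk] using this
  have hΦ : twist α σ w = w := by
    rw [hw, twist_sum]
    simp only [← Function.iterate_succ_apply']
    have h3 := Finset.sum_range_succ (fun i => (twist α σ)^[i] (c • ((1, 0) : K × K))) m
    rw [Finset.sum_range_succ'] at h3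
    have h4 : (twist α σ)^[m] (c • ((1, 0) : K × K)) = c • (1, 0) := LinearMap.congr_fun h1 _
    rw [h4] at h3
    exact add_right_cancel h3
  refine hns w hw0 ?_
  rw [hΦ]
  simp [planeDet, mul_comm]

/-- Vectors with the same nonzero value of the family are related by the centralizer. -/
theorem exists_mem_twistCentralizer
    (hns : ∀ v : K × K, v ≠ 0 → planeDet (twist α σ v) v ≠ 0) {v w : K × K} (hv : v ≠ 0)
    (h1 : planeDet (twist α σ v) v = planeDet (twist α σ w) w)
    (h2 : planeDet (twist α σ (twist α σ v)) v = planeDet (twist α σ (twist α σ w)) w) :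
    ∃ θ ∈ twistCentralizer α σ, θ v = w := by
  have hc := hns v hv
  set c := planeDet (twist α σ v) v with hcdef
  let Φ := twist α σ
  -- The linear map with v ↦ w and Φv ↦ Φw, written by Cramer's rule.
  let θ : K × K →ₗ[K] K × K :=
    { toFun := fun u => c⁻¹ • (planeDet u v • Φ w + planeDet (Φ v) u • w)
      map_add' := fun u u' => by
        ext <;> simp [planeDet] <;> ring
      map_smul' := fun r u => by
        ext <;> simp [planeDet] <;> ring }
  have hθ : ∀ u, θ u = c⁻¹ • (planeDet u v • Φ w + planeDet (Φ v) u • w) := fun u => rfl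
  have self : ∀ u : K × K, planeDet u u = 0 := fun u => by simp [planeDet, mul_comm]
  have hθv : θ v = w := by
    rw [hθ, self, zero_smul, zero_add, smul_smul, ← hcdef, inv_mul_cancel₀ hc, one_smul]
  have hθΦv : θ (Φ v) = Φ w := by
    rw [hθ, self, zero_smul, add_zero, smul_smul, ← hcdef, inv_mul_cancel₀ hc, one_smul]
  have swap : ∀ u u' : K × K, planeDet u u' = - planeDet u' u := fun u u' => by
    simp [planeDet, mul_comm]
  -- Φ²v has the same coordinates in (Φv, v) as Φ²w in (Φw, w): one comes from h2, the other is
  -- determined by det(Φ²v, Φv) = -α⁻¹σ(det(Φv, v)). Hence θ commutes with Φ on a basis.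
  have hΦΦ : θ (Φ (Φ v)) = Φ (Φ w) := by
    rw [hθ, inv_smul_eq_iff₀ hc, h2, h1, planeDet_smul_eq w (Φ w) (Φ (Φ w)), swap (Φ v),
      swap (Φ w) (Φ (Φ w)), planeDet_twist_twist, planeDet_twist_twist, ← hcdef, h1]
  refine ⟨θ, fun u => ?_, hθv⟩
  obtain ⟨a, b, rfl⟩ : ∃ a b : K, u = a • Φ v + b • v :=
    ⟨c⁻¹ * planeDet u v, c⁻¹ * planeDet (Φ v) u, by
      rw [mul_smul, mul_smul, ← smul_add, eq_inv_smul_iff₀ hc, hcdef, planeDet_smul_eq]⟩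
  simp only [twist_add, twist_smul, map_add, map_smul, hθv]
  change σ a • θ (Φ (Φ v)) + σ b • θ (Φ v) = σ a • Φ (θ (Φ v)) + σ b • Φ w
  rw [hΦΦ, hθΦv]

theorem isThreeToOne_extFamily_of_fixed [CharP K 2] {m : ℕ} (hm : 0 < m)
    (hσm : ∀ x, σ^[m] x = x)
    (hinj : ∀ i < m, ∀ j < m, (∀ x, σ^[i] x = σ^[j] x) → i = j)
    (hfix : ∀ x : K, σ x = x → x = 0 ∨ x = 1)
    (hα : ∀ x : K, σ x * x + x + α ≠ 0) : IsThreeToOne (extFamily α σ) := by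
  have hα0 : α ≠ 0 := by simpa using hα 0
  have hσα : σ α ≠ 0 := by simpa using hα0
  have hns : ∀ v : K × K, v ≠ 0 → planeDet (twist α σ v) v ≠ 0 :=
    fun v hv => planeDet_twist_ne_zero σ hα hv
  have hF0 : ∀ v, extFamily α σ v = 0 ↔ v = 0 := fun v => by
    constructor
    · intro h
      by_contra hv
      rw [extFamily_eq_planeDet hα0] at h
      exact mul_ne_zero hα0 (hns v hv) (congrArg Prod.fst h)
    · rintro rfl
      simp [extFamily]
  refine ⟨hF0, ?_⟩
  rintro _ ⟨v, rfl⟩ hy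
  have hv : v ≠ 0 := fun h => hy ((hF0 v).2 h)
  set ω := iterateTwist α σ m hσm with hω_def
  have hω1 : ω ≠ 1 := iterateTwist_ne_one hm hσm hinj hns
  have hω : ω ∈ twistCentralizer α σ := fun u =>
    (Function.iterate_succ_apply _ m u).symm.trans (Function.iterate_succ_apply' _ m u)
  have hω0 : ω ≠ 0 := by
    have hpow : ∀ i, (twist α σ)^[i] v ≠ 0 := fun i => by
      induction i with
      | zero => exact hv
      | succ i ih =>
        rw [Function.iterate_succ_apply']
        intro h
        have := hns _ ih
        rw [h] at this
        simp [planeDet] at this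
    exact fun h => hpow m (LinearMap.congr_fun h v)
  have hω10 : ω + 1 ≠ 0 := fun h => hω1 (by
    have h' : (1 : K × K →ₗ[K] K × K) + 1 = 0 := by
      ext <;> simp [CharTwo.add_self_eq_zero]
    exact add_right_cancel (h.trans h'.symm))
  have hω1m := add_mem hω one_mem_twistCentralizer
  -- Commuting with Φ and having determinant 1 preserves both determinants that make up the family.
  have hinv : ∀ θ ∈ twistCentralizer α σ, θ ≠ 0 →
      extFamily α σ (θ v) = extFamily α σ v := fun θ hθ hθ0 => by
    rw [extFamily_eq_planeDet hα0, extFamily_eq_planeDet hα0, ← hθ, ← hθ, planeDet_map,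
      planeDet_map, endDet_eq_one hα0 hfix hns hθ hθ0, one_mul, one_mul]
  have hset : extFamily α σ ⁻¹' {extFamily α σ v} = {v, ω v, (ω + 1) v} := by
    ext w
    simp only [Set.mem_preimage, Set.mem_singleton_iff, Set.mem_insert_iff]
    constructor
    · intro h
      have hw : w ≠ 0 := fun hw0 => hy (by rw [← h]; exact (hF0 w).2 hw0)
      rw [extFamily_eq_planeDet hα0, extFamily_eq_planeDet hα0] at h
      have h1 := mul_left_cancel₀ hα0 (congrArg Prod.fst h)
      have h2 := mul_left_cancel₀ (mul_ne_zero hα0 hσα) (congrArg Prod.snd h)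
      obtain ⟨θ, hθ, rfl⟩ := exists_mem_twistCentralizer hns hv h1.symm h2.symm
      have hθ0 : θ ≠ 0 := fun h0 => hw (by simp [h0])
      rcases mem_twistCentralizer_cases hα0 hfix hns hω hω0 hω1 hθ hθ0 with rfl | rfl | rfl
      · exact Or.inl rfl
      · exact Or.inr (Or.inl rfl)
      · exact Or.inr (Or.inr rfl)
    · rintro (rfl | rfl | rfl)
      · rfl
      · exact hinv _ hω hω0
      · exact hinv _ hω1m hω10
  rw [hset, Set.ncard_eq_three]
  refine ⟨_, _, _, fun h => ?_, fun h => ?_, fun h => ?_, rfl⟩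
  · exact hω1 (eq_of_apply_eq hns hω one_mem_twistCentralizer hv h.symm)
  · have := eq_of_apply_eq hns hω1m one_mem_twistCentralizer hv h.symm
    exact hω0 (by simpa using this)
  · have := eq_of_apply_eq hns hω1m hω hv h.symm
    exact absurd (add_eq_left.1 this) fun h1 => hv (by simpa using LinearMap.congr_fun h1 v)

end SemilinearTwist

/-! ### The fixed field and the order of x ↦ x^(2^k) for k coprime to m. -/

section FrobeniusPower

variable {K : Type*} [Field K]

theorem iterate_of_eq_pow {σ : K ≃+* K} {k : ℕ} (hσ : ∀ x, σ x = x ^ (2 ^ k)) (i : ℕ) (x : K) :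
    σ^[i] x = x ^ (2 ^ (k * i)) := by
  induction i with
  | zero => simp
  | succ i ih => rw [Function.iterate_succ_apply', ih, hσ, ← pow_mul, ← pow_add, mul_add_one]

theorem pow_two_pow_gcd {x : K} {a b : ℕ} (ha : x ^ 2 ^ a = x) (hb : x ^ 2 ^ b = x) :
    x ^ 2 ^ (a.gcd b) = x := by
  have key : ∀ i, x ^ 2 ^ i = x ↔ Function.IsPeriodicPt (fun y : K => y ^ 2) i x := fun i => by
    rw [Function.IsPeriodicPt, Function.IsFixedPt, pow_iterate]
  rw [key] at *
  exact ha.gcd hb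

variable [Fintype K]

/-- With g = gcd(a, m), every element of K is a root of X^(2^g) - X, so 2^m ≤ 2^g and g = m. -/
theorem dvd_of_forall_pow_two_pow {m a : ℕ} (hm : 0 < m) (hK : Fintype.card K = 2 ^ m)
    (h : ∀ x : K, x ^ 2 ^ a = x) : m ∣ a := by
  have hg : ∀ x : K, x ^ 2 ^ (a.gcd m) = x := fun x =>
    pow_two_pow_gcd (h x) (by rw [← hK, FiniteField.pow_card])
  have hpos : 0 < a.gcd m := Nat.gcd_pos_of_pos_right _ hm
  have hlt : 1 < 2 ^ a.gcd m := Nat.one_lt_two_pow hpos.ne'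
  have hle : 2 ^ m ≤ 2 ^ a.gcd m := by
    rw [← hK, ← Finset.card_univ, ← FiniteField.X_pow_card_sub_X_natDegree_eq K hlt]
    refine Polynomial.card_le_degree_of_subset_roots fun x _ => ?_
    rw [Polynomial.mem_roots (FiniteField.X_pow_card_sub_X_ne_zero K hlt)]
    simp [hg x]
  have := (Nat.pow_le_pow_iff_right one_lt_two).1 hle
  have heq : a.gcd m = m := le_antisymm (Nat.gcd_le_right _ hm) this
  exact Nat.gcd_eq_right_iff_dvd.1 heq

theorem isThreeToOne_extFamily {m k : ℕ} (hm : 0 < m) (hK : Fintype.card K = 2 ^ m)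
    [CharP K 2] (hkm : Nat.Coprime k m) {σ : K ≃+* K} (hσ : ∀ x, σ x = x ^ (2 ^ k)) {α : K}
    (hα : ∀ x : K, σ x * x + x + α ≠ 0) : IsThreeToOne (extFamily α σ) := by
  have hfr : ∀ x : K, x ^ 2 ^ m = x := fun x => by rw [← hK, FiniteField.pow_card]
  refine isThreeToOne_extFamily_of_fixed hm (fun x => ?_) ?_ (fun x hx => ?_) hα
  · rw [iterate_of_eq_pow hσ, mul_comm, pow_mul, ← hK, FiniteField.pow_card_pow]
  · have key : ∀ i < m, ∀ j < m, i ≤ j → (∀ x, σ^[i] x = σ^[j] x) → i = j := by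
      intro i hi j hj hij h
      obtain ⟨d, rfl⟩ := Nat.exists_eq_add_of_le hij
      have hd : m ∣ k * d := dvd_of_forall_pow_two_pow hm hK fun x => by
        rw [← iterate_of_eq_pow hσ]
        have := h x
        rw [Function.iterate_add_apply] at this
        exact (σ.injective.iterate i this).symm
      have := hkm.symm.dvd_of_dvd_mul_left hd
      have := Nat.eq_zero_of_dvd_of_lt this (by omega)
      omega
    intro i hi j hj h
    rcases le_total i j with hij | hij
    · exact key i hi j hj hij h
    · exact (key j hj i hi hij fun x => (h x).symm).symm
  · rw [hσ] at hx
    have := pow_two_pow_gcd hx (hfr x)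
    rw [hkm.gcd_eq_one, pow_one] at this
    have : x * (x - 1) = 0 := by linear_combination this
    exact (mul_eq_zero.1 this).imp_right sub_eq_zero.1

end FrobeniusPower

/-! ### APN from the polar form, and the lower bound on the image size. -/

section APN

variable {V : Type*} [AddCommGroup V] [Fintype V]

open Classical in
theorem isAPN_of_form {F : V → V} (h2 : ∀ x : V, x + x = 0) (B : V →+ V →+ V)
    (hB : ∀ x y, F (x + y) = F x + F y + B x y)
    (hker : ∀ x y, x ≠ 0 → B x y = 0 → y = 0 ∨ y = x) (hne : ∃ a : V, a ≠ 0) : IsAPN F := by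
  have hF0 : F 0 = 0 := by simpa using hB 0 0
  refine le_antisymm (Finset.sup_le fun p hp => ?_) ?_
  · obtain ⟨a, b⟩ := p
    have ha : a ≠ 0 := by simpa using hp
    dsimp only
    rcases (Finset.univ.filter fun x => F (x + a) + F x = b).eq_empty_or_nonempty with h | ⟨x₀, hx₀⟩
    · simp [h]
    · refine (Finset.card_le_card (t := {x₀, a + x₀}) fun x hx => ?_).trans Finset.card_le_two
      have key : ∀ x, F (x + a) + F x = F a + B a x := fun x => by
        rw [add_comm x a, hB, add_assoc, add_assoc, add_comm (B a x), ← add_assoc (F x), h2,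
          zero_add]
      simp only [Finset.mem_filter, Finset.mem_univ, true_and, key] at hx hx₀
      have := hker a (x - x₀) ha (by rw [map_sub, sub_eq_zero]; exact add_left_cancel (hx.trans hx₀.symm))
      rw [sub_eq_zero, sub_eq_iff_eq_add] at this
      simpa using this
  · obtain ⟨a, ha⟩ := hne
    -- Direction a with right-hand side F a attains the bound: both 0 and a are solutions.
    have hmem : ((a, F a) : V × V) ∈ (Finset.univ.erase (0 : V)) ×ˢ (Finset.univ : Finset V) := by
      simpa using ha
    refine le_trans ?_ (Finset.le_sup (f := fun p : V × V =>
      (Finset.univ.filter fun x : V => F (x + p.1) + F x = p.2).card) hmem)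
    rw [← Finset.card_pair ha.symm]
    refine Finset.card_le_card fun x hx => ?_
    rw [Finset.mem_insert, Finset.mem_singleton] at hx
    rcases hx with rfl | rfl <;> simp [hF0, h2]

-- Cauchy–Schwarz gives |V|² ≤ |Im G| · Σ N(y)², with N(y) the fibre sizes. The sum counts pairs
-- with equal values: |V| from a = 0 and at most 2 for each a ≠ 0, so at most 3|V| - 2.
open Classical in
theorem IsAPN.card_sq_le {G : V → V} (h2 : ∀ x : V, x + x = 0) (hG : IsAPN G) :
    Fintype.card V ^ 2 + 2 * (Set.range G).ncard ≤ (Set.range G).ncard * (3 * Fintype.card V) := by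
  set I := Finset.univ.image G with hI
  have hr : (Set.range G).ncard = I.card := by
    rw [← Set.ncard_coe_finset]; simp [hI]
  let N : V → ℕ := fun y => (Finset.univ.filter fun x => G x = y).card
  have h1 : Fintype.card V = ∑ y ∈ I, N y :=
    Finset.card_eq_sum_card_image G Finset.univ
  have h3 : ∑ y ∈ I, N y ^ 2 = ∑ a, (Finset.univ.filter fun x => G (x + a) + G x = 0).card := by
    have e : ∀ x, N (G x) = ∑ a, if G (x + a) + G x = 0 then 1 else 0 := fun x => by
      simp only [N, Finset.card_filter]
      refine (Fintype.sum_equiv (Equiv.addLeft x) _ _ fun a => ?_).symm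
      have : G (x + a) + G x = 0 ↔ G (x + a) = G x := by
        rw [add_eq_zero_iff_eq_neg, neg_eq_of_add_eq_zero_left (h2 (G x))]
      by_cases hx : G (x + a) = G x <;> simp [this, hx, h2]
    have e2 := Finset.sum_comp (s := Finset.univ) (f := N) G
    simp only [smul_eq_mul] at e2
    rw [← hI] at e2
    change _ = ∑ y ∈ I, N y * N y at e2
    simp only [sq]
    rw [← e2, Finset.sum_congr rfl fun x _ => e x, Finset.sum_comm]
    simp only [Finset.card_filter]
  have h4 : ∑ a, (Finset.univ.filter fun x => G (x + a) + G x = 0).card + 2 ≤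
      3 * Fintype.card V := by
    rw [← Finset.add_sum_erase _ _ (Finset.mem_univ (0 : V))]
    have h5 : ∀ a ∈ Finset.univ.erase (0 : V),
        (Finset.univ.filter fun x => G (x + a) + G x = 0).card ≤ 2 := fun a ha => by
      rw [← show differentialUniformity G = 2 from hG]
      exact Finset.le_sup (f := fun p : V × V =>
        (Finset.univ.filter fun x : V => G (x + p.1) + G x = p.2).card) (b := (a, 0))
        (by simpa using ha)
    have h6 := Finset.sum_le_card_nsmul _ _ _ h5
    have h7 : (Finset.univ.erase (0 : V)).card + 1 = Fintype.card V :=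
      Finset.card_erase_add_one (Finset.mem_univ _)
    have h8 := Finset.card_le_univ (Finset.univ.filter fun x => G (x + 0) + G x = 0)
    rw [smul_eq_mul] at h6
    omega
  have h9 := sq_sum_le_card_mul_sum_sq (s := I) (f := N)
  rw [← h1, h3, Nat.cast_id] at h9
  rw [hr]
  calc _ ≤ I.card * ∑ a, (Finset.univ.filter fun x => G (x + a) + G x = 0).card + 2 * I.card := by
        gcongr
    _ = I.card * (∑ a, (Finset.univ.filter fun x => G (x + a) + G x = 0).card + 2) := by ring
    _ ≤ _ := by gcongr

theorem IsThreeToOne.ncard_range_le {F G : V → V} (h2 : ∀ x : V, x + x = 0)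
    (hF : IsThreeToOne F) (hG : IsAPN G) : (Set.range F).ncard ≤ (Set.range G).ncard := by
  by_contra! hlt
  have h1 := hF.three_mul_ncard_range
  have h3 := hG.card_sq_le h2
  have hpos : 0 < Fintype.card V := Fintype.card_pos
  -- A smaller image would have 3|Im G| ≤ |V| - 1, which contradicts the quadratic bound h3.
  have h4 : 3 * (Set.range G).ncard + 1 ≤ Fintype.card V := by omega
  nlinarith

end APN

/-! ### Transport from the plane to the field of size 2^(2m), and the main theorem. -/

theorem IsThreeToOne.conj {V W : Type*} [AddCommGroup V] [AddCommGroup W] {F : V → V}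
    (hF : IsThreeToOne F) (e : V ≃+ W) : IsThreeToOne fun z => e (F (e.symm z)) := by
  refine ⟨fun x => by simp [hF.1], ?_⟩
  rintro _ ⟨z, rfl⟩ hz
  have h := hF.2 _ ⟨e.symm z, rfl⟩ (by simpa using hz)
  rw [← h, ← Set.ncard_image_of_injective _ e.injective]
  congr 1
  ext w
  simp only [Set.mem_preimage, Set.mem_singleton_iff, Set.mem_image, EmbeddingLike.apply_eq_iff_eq]
  exact ⟨fun hw => ⟨e.symm w, hw, by simp⟩, by rintro ⟨x, hx, rfl⟩; simpa using hx⟩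

/-- The polarization of `extFamily`. -/
def extFamilyPolar {K : Type*} [Field K] (α : K) (σ : K ≃+* K) : K × K →+ K × K →+ K × K :=
  AddMonoidHom.mk' (fun v => AddMonoidHom.mk' (fun w =>
    (σ v.1 * w.1 + σ w.1 * v.1 + v.1 * σ w.2 + w.1 * σ v.2 + α * (σ v.2 * w.2 + σ w.2 * v.2),
     σ (σ v.1) * w.1 + σ (σ w.1) * v.1 + α * (σ (σ v.1) * w.2 + σ (σ w.1) * v.2)
       + (1 + σ α) * (v.1 * σ (σ w.2) + w.1 * σ (σ v.2))
       + α * (σ (σ v.2) * w.2 + σ (σ w.2) * v.2)))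
    (fun w w' => by ext <;> simp <;> ring))
    (fun v v' => by ext <;> simp <;> ring)

theorem extFamily_add {K : Type*} [Field K] (α : K) (σ : K ≃+* K) (v w : K × K) :
    extFamily α σ (v + w) = extFamily α σ v + extFamily α σ w + extFamilyPolar α σ v w := by
  ext <;> simp [extFamily, extFamilyPolar] <;> ring

/-- Transport of a biadditive map along an additive equivalence. -/
def AddEquiv.conjForm {V W : Type*} [AddCommGroup V] [AddCommGroup W] (e : V ≃+ W)
    (B : V →+ V →+ V) : W →+ W →+ W :=
  AddMonoidHom.mk' (fun x => AddMonoidHom.mk' (fun y => e (B (e.symm x) (e.symm y))) (by simp))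
    (fun x y => by ext; simp)

theorem exists_addEquiv_galoisField {K : Type*} [Field K] [Fintype K] [CharP K 2] {m : ℕ}
    (hm : 0 < m) (hK : Fintype.card K = 2 ^ m) : Nonempty (K × K ≃+ GaloisField 2 (2 * m)) := by
  let := ZMod.algebra K 2
  have h : Module.finrank (ZMod 2) (K × K) = Module.finrank (ZMod 2) (GaloisField 2 (2 * m)) := by
    refine Nat.pow_right_injective (le_refl 2) ?_
    dsimp only
    rw [GaloisField.finrank 2 (by omega)]
    have := Module.card_eq_pow_finrank (K := ZMod 2) (V := K × K)
    rw [ZMod.card, Fintype.card_prod, hK] at this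
    rw [← this, two_mul, pow_add]
  exact ⟨(LinearEquiv.ofFinrankEq _ _ h).toAddEquiv⟩

theorem mainTheorem3 {K : Type*} [Field K] [Fintype K] (m k : ℕ)
    (hK : Fintype.card K = 2 ^ m) (hkm : Nat.Coprime k m)
    (σ : K ≃+* K) (hσ : ∀ x, σ x = x ^ (2 ^ k))
    (α : K) (hα : ∀ x : K, σ x * x + x + α ≠ 0) :
    IsAPN (extFamily α σ) ∧
    IsThreeToOne (extFamily α σ) ∧
    (∀ G : K × K → K × K, IsAPN G →
      (Set.range (extFamily α σ)).ncard ≤ (Set.range G).ncard) ∧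
    (∀ {L : Type*} [Field L] [Fintype L] [Algebra (ZMod 2) L] (e : K × K ≃+ L),
      HasClassicalWalshSpectrum (2 * m) (fun z => e (extFamily α σ (e.symm z)))) := by
  have hm : 0 < m := Nat.pos_of_ne_zero fun h => by
    subst h
    have := Fintype.one_lt_card (α := K)
    rw [hK] at this
    simp at this
  have : CharP K 2 := by
    have : Fact (Nat.Prime 2) := ⟨Nat.prime_two⟩
    exact charP_of_card_eq_prime_pow hK
  have h2 : ∀ x : K × K, x + x = 0 := fun x => by
    ext <;> simp [CharTwo.add_self_eq_zero]
  have h3 := isThreeToOne_extFamily hm hK hkm hσ hα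
  have hcard : ∀ {L : Type _} [Fintype L] (e : K × K ≃ L), Fintype.card L = 2 ^ (2 * m) :=
    fun e => by rw [← Fintype.card_congr e, Fintype.card_prod, hK, two_mul, pow_add]
  refine ⟨?_, h3, fun G hG => h3.ncard_range_le h2 hG, fun {L} _ _ _ e => ?_⟩
  -- The kernel count uses the trace form of a field, so APN is proved through an auxiliary additive
  -- identification of the plane with one.
  · obtain ⟨e⟩ := exists_addEquiv_galoisField hm hK
    let : Fintype (GaloisField 2 (2 * m)) := Fintype.ofFinite _
    refine isAPN_of_form h2 (extFamilyPolar α σ) (extFamily_add α σ) (fun x y hx hxy => ?_)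
      (exists_ne 0)
    have := eq_or_eq_of_form_eq_zero (B := e.conjForm (extFamilyPolar α σ))
      (H := fun z => e (extFamily α σ (e.symm z)))
      (fun x y => by simp [extFamily_add, AddEquiv.conjForm]) (h3.conj e) (hcard e.toEquiv)
      (x := e x) (y := e y) (by simpa using hx) (by simp [AddEquiv.conjForm, hxy])
    simpa using this
  · exact hasClassicalWalshSpectrum_of_quadratic (B := e.conjForm (extFamilyPolar α σ))
      (fun x y => by simp [extFamily_add, AddEquiv.conjForm]) (h3.conj e) hm
      (by rw [← Fintype.card_congr e.toEquiv, Fintype.card_prod, hK, two_mul, pow_add])
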